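/- **Setting.** Let $(\bar M,\bar g,\bar J)$ be an indefinite Kähler manifold: $\bar g$ is a semi-Riemannian metric of constant index $q$, $0<q<\dim\bar M$, $\bar J$ is an almost complex structure with $\bar g(\bar JX,\bar JY)=\bar g(X,Y)$, and $\bar J$ is parallel for the Levi-Civita connection $\bar\nabla$ of $\bar g$. Let $M$ be an (immersed) submanifold of $\bar M$ with induced, possibly degenerate metric $g$, such that $\mathrm{Rad}(TM)=TM\cap TM^{\perp}$ has constant rank $r\ge 1$ (a lightlike submanifold). Fix smooth complements $S(TM)$ and $S(TM^\perp)$ of $\mathrm{Rad}(TM)$ in $TM$ and in $TM^\perp$, and a totally null complement $ltr(TM)$ of $\mathrm{Rad}(TM)$ in $(S(TM)\perp S(TM^\perp))^\perp$; put $tr(TM)=ltr(TM)\perp S(TM^\perp)$. Then $$T\bar M|_M=TM\oplus tr(TM),\qquad TM=S(TM)\perp\mathrm{Rad}(TM).$$ For $X,Y\in\Gamma(TM)$ let $\nabla_XY$ and $h(X,Y)$ be the $TM$-part and the $tr(TM)$-part of $\bar\nabla_XY$, and let $h^s(X,Y)$ be the $S(TM^\perp)$-part of $h(X,Y)$. For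 a section $W$ of $S(TM^\perp)$ let $A_WX$ be minus the $TM$-part of $\bar\nabla_XW$; for a section $\xi$ of $\mathrm{Rad}(TM)$ let $A^*_\xi X$ be minus the $S(TM)$-part of $\nabla_X\xi$. * $M$ is *totally umbilical* if $h(X,Y)=g(X,Y)H$ for all $X,Y\in\Gamma(TM)$, for some smooth section $H$ of $tr(TM)$. * $M$ is *minimal* (Bejan–Duggal) if $h^s=0$ on $\mathrm{Rad}(TM)$ and the trace of $h$ with respect to $g$ restricted to $S(TM)$ is zero. * $M$ is *STCR (screen transversal Cauchy Riemann) lightlike* if there are subbundles $D_1,D_2$ of $\mathrm{Rad}(TM)$, $D_0,D'$ of $S(TM)$, $L_1$ of $ltr(TM)$ and $S$ of $S(TM^\perp)$ with $$\mathrm{Rad}(TM)=D_1\oplus D_2,\quad \bar J(D_1)\subset S(TM),\quad \bar J(D_2)\subset S(TM^\perp),$$ $$S(TM)=\{\bar J(D_1)\oplus D'\}\perp D_0,\quad \bar J(D_0)=D_0,\quad \bar J(D')=L_1\perp S,$$ where $D_0$ is non-degenerate. For a non-degenerate distribution $B\subset TM$ and $A:TM\to TM$, $\mathrm{trace}\,A|_B=\sum_i\varepsilon_i\,g(Ae_i,e_i)$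 for a $g$-orthonormal basis $(e_i)$ of $B$, $\varepsilon_i=g(e_i,e_i)=\pm1$. **Theorem 5.1.** Let $M$ be a totally umbilical STCR lightlike submanifold of an indefinite Kähler manifold $\bar M$, and assume that $D_0\perp\bar J(S)$ is non-zero at every point at which $D_1$ is non-zero. Then $M$ is minimal if and only if $$\mathrm{trace}\,A_{W}|_{D_0\perp\bar J(S)}=0\quad\text{and}\quad \mathrm{trace}\,A^*_{\xi}|_{D_0\perp\bar J(S)}=0$$ for all local sections $W$ of $S(TM^\perp)$ and $\xi$ of $\mathrm{Rad}(TM)$ (equivalently, for the members $W_j$, $\xi_k$ of local frames of these bundles). -/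

import Mathlib

open Bundle Module
open scoped Manifold ContDiff

noncomputable section

namespace LightlikeGeometry

/-! ### Linear algebra of a symmetric bilinear form -/

section LinearAlgebra

variable {V : Type*} [AddCommGroup V] [Module ℝ V]

/-- `q` is the index of `B`: the largest dimension of a subspace on which `B` is negative
definite. -/
def HasIndex (B : LinearMap.BilinForm ℝ V) (q : ℕ) : Prop :=
  IsGreatest {d : ℕ | ∃ W : Submodule ℝ V, finrank ℝ W = d ∧ ∀ w ∈ W, w ≠ 0 → B w w < 0} q

/-- The trace with respect to `B` restricted to `A` of a vector valued bilinear map `T`, that is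
`∑ᵢⱼ Gⁱʲ T(bᵢ, bⱼ)`, where `(bᵢ)` is a basis of `A` and `(Gⁱʲ)` is the inverse of the Gram matrix
`(B(bᵢ, bⱼ))`. If `B` is nondegenerate on `A`, it does not depend on the basis; it is
`∑ᵢ εᵢ T(eᵢ, eᵢ)` for any orthonormal basis `(eᵢ)` with signs `εᵢ = B(eᵢ, eᵢ) = ±1`
(see `metricTrace_eq_sum`). -/
def metricTrace [FiniteDimensional ℝ V] {U : Type*} [AddCommGroup U] [Module ℝ U] (B : LinearMap.BilinForm ℝ V)
    (A : Submodule ℝ V) (T : V →ₗ[ℝ] V →ₗ[ℝ] U) : U :=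
  let b := finBasis ℝ A
  let G : Matrix (Fin (finrank ℝ A)) (Fin (finrank ℝ A)) ℝ :=
    Matrix.of fun i j ↦ B (b i : V) (b j : V)
  ∑ i, ∑ j, G⁻¹ i j • T (b i : V) (b j : V)

theorem metricTrace_eq_sum [FiniteDimensional ℝ V] {U : Type*} [AddCommGroup U] [Module ℝ U]
    (B : LinearMap.BilinForm ℝ V) (A : Submodule ℝ V) (T : V →ₗ[ℝ] V →ₗ[ℝ] U)
    (e : Basis (Fin (finrank ℝ A)) ℝ A) (ε : Fin (finrank ℝ A) → ℝ)
    (hε : ∀ i, ε i = 1 ∨ ε i = -1)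
    (he : ∀ i j, B (e i : V) (e j : V) = if i = j then ε i else 0) :
    metricTrace B A T = ∑ i, ε i • T (e i : V) (e i : V) := by
  set b := finBasis ℝ A with hb
  set Q := e.toMatrix b with hQ
  have hQu : IsUnit Q.det := by
    rw [← Matrix.isUnit_iff_isUnit_det]
    have := e.invertibleToMatrix b
    exact isUnit_of_invertible Q
  have hbe : ∀ i, (b i : V) = ∑ k, Q k i • (e k : V) := by
    intro i
    have := congrArg (Subtype.val) (e.sum_toMatrix_smul_self (v := b) i)
    rw [AddSubmonoidClass.coe_finsetSum] at this
    exact this.symm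
  have hG : (Matrix.of fun i j ↦ B (b i : V) (b j : V)) = Q.transpose * Matrix.diagonal ε * Q := by
    ext i j
    simp only [Matrix.of_apply, hbe, map_sum, LinearMap.sum_apply, map_smul, LinearMap.smul_apply,
      he]
    rw [Matrix.mul_apply]
    refine Finset.sum_congr rfl fun k _ ↦ ?_
    rw [Matrix.mul_diagonal, Matrix.transpose_apply]
    simp [mul_comm]
  have hD : Matrix.diagonal ε * Matrix.diagonal ε = 1 := by
    rw [Matrix.diagonal_mul_diagonal, ← Matrix.diagonal_one]
    congr 1
    funext i
    rcases hε i with h | h <;> simp [h]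
  have hDi : (Matrix.diagonal ε)⁻¹ = Matrix.diagonal ε := Matrix.inv_eq_right_inv hD
  have hkey : Q * (Matrix.of fun i j ↦ B (b i : V) (b j : V))⁻¹ * Q.transpose =
      Matrix.diagonal ε := by
    rw [hG, Matrix.mul_inv_rev, Matrix.mul_inv_rev, hDi, ← Matrix.mul_assoc, ← Matrix.mul_assoc,
      Matrix.mul_nonsing_inv _ hQu, Matrix.one_mul, Matrix.mul_assoc,
      Matrix.nonsing_inv_mul _ (by rwa [Matrix.det_transpose]), Matrix.mul_one]
  have h1 : ∀ k l, ∑ i, ∑ j, Q k i * (Matrix.of fun i j ↦ B (b i : V) (b j : V))⁻¹ i j * Q l j =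
      Matrix.diagonal ε k l := by
    intro k l
    rw [← hkey, Matrix.mul_apply, Finset.sum_comm]
    refine Finset.sum_congr rfl fun j _ ↦ ?_
    rw [Matrix.mul_apply, Matrix.transpose_apply, Finset.sum_mul]
  have h2 : metricTrace B A T = ∑ k, ∑ l, Matrix.diagonal ε k l • T (e k : V) (e l : V) := by
    simp only [← h1, metricTrace, Finset.sum_smul]
    set G := (Matrix.of fun i j ↦ B (b i : V) (b j : V))⁻¹
    have h3 : ∀ i j, G i j • T (b i : V) (b j : V) =
        ∑ k, ∑ l, (Q k i * G i j * Q l j) • T (e k : V) (e l : V) := by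
      intro i j
      simp only [hbe, map_sum, LinearMap.sum_apply, map_smul, LinearMap.smul_apply, Finset.smul_sum,
        smul_smul]
      rw [Finset.sum_comm]
      refine Finset.sum_congr rfl fun k _ ↦ Finset.sum_congr rfl fun l _ ↦ ?_
      congr 1
      ring
    calc _ = ∑ i, ∑ j, ∑ k, ∑ l, (Q k i * G i j * Q l j) • T (e k : V) (e l : V) :=
          Finset.sum_congr rfl fun i _ ↦ Finset.sum_congr rfl fun j _ ↦ h3 i j
      _ = ∑ i, ∑ k, ∑ j, ∑ l, (Q k i * G i j * Q l j) • T (e k : V) (e l : V) :=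
          Finset.sum_congr rfl fun i _ ↦ Finset.sum_comm
      _ = ∑ k, ∑ i, ∑ j, ∑ l, (Q k i * G i j * Q l j) • T (e k : V) (e l : V) := Finset.sum_comm
      _ = ∑ k, ∑ i, ∑ l, ∑ j, (Q k i * G i j * Q l j) • T (e k : V) (e l : V) :=
          Finset.sum_congr rfl fun k _ ↦ Finset.sum_congr rfl fun i _ ↦ Finset.sum_comm
      _ = _ := Finset.sum_congr rfl fun k _ ↦ Finset.sum_comm
  rw [h2]
  refine Finset.sum_congr rfl fun k _ ↦ ?_
  rw [Finset.sum_eq_single k (fun l _ hl ↦ by rw [Matrix.diagonal_apply_ne' _ hl, zero_smul])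
    (by simp), Matrix.diagonal_apply_eq]

/-- The fibrewise decomposition of the ambient tangent space of a lightlike submanifold. -/
theorem isCompl_splitting [FiniteDimensional ℝ V] {B : LinearMap.BilinForm ℝ V}
    (hB : B.Nondegenerate) (hs : ∀ u v, B u v = B v u) {T S R C L : Submodule ℝ V}
    (hR : R = T ⊓ B.orthogonal T) (hSR : Disjoint S R) (hST : S ⊔ R = T)
    (hCR : Disjoint C R) (hCT : C ⊔ R = B.orthogonal T) (hL : R ⊔ L = B.orthogonal (S ⊔ C)) :
    Disjoint S C ∧ IsCompl (S ⊔ C) (R ⊔ L) := by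
  have hrefl : B.IsRefl := fun u v h ↦ by rw [hs]; exact h
  have hS : S ≤ T := hST ▸ le_sup_left
  have hC : C ≤ B.orthogonal T := hCT ▸ le_sup_left
  have hRT : R ≤ T := hR ▸ inf_le_left
  have hRT' : R ≤ B.orthogonal T := hR ▸ inf_le_right
  have key : ∀ x ∈ T, x ∈ B.orthogonal T → x ∈ R := fun x h h' ↦ hR ▸ ⟨h, h'⟩
  refine ⟨?_, ?_⟩
  · rw [Submodule.disjoint_def]
    intro x hx hx'
    exact Submodule.disjoint_def.1 hSR x hx (key x (hS hx) (hC hx'))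
  · rw [hL, LinearMap.BilinForm.isCompl_orthogonal_iff_disjoint hrefl, Submodule.disjoint_def]
    intro x hx hx'
    obtain ⟨a, ha, c, hc, rfl⟩ := Submodule.mem_sup.1 hx
    rw [LinearMap.BilinForm.mem_orthogonal_iff] at hx'
    have ha0 : a ∈ B.orthogonal T := by
      rw [← hST, LinearMap.BilinForm.mem_orthogonal_iff]
      intro y hy
      obtain ⟨s, hsS, t, ht, rfl⟩ := Submodule.mem_sup.1 hy
      have h1 : B s (a + c) = 0 := hx' s (Submodule.mem_sup_left hsS)
      have h2 : B s c = 0 := hC hc s (hS hsS)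
      have h3 : B t a = 0 := by rw [hs]; exact hRT' ht a (hS ha)
      rw [map_add, h2, add_zero] at h1
      change B (s + t) a = 0
      rw [map_add, LinearMap.add_apply, h1, h3, add_zero]
    have hc0 : c ∈ B.orthogonal (B.orthogonal T) := by
      rw [← hCT, LinearMap.BilinForm.mem_orthogonal_iff]
      intro y hy
      obtain ⟨s, hsS, t, ht, rfl⟩ := Submodule.mem_sup.1 hy
      have h1 : B s (a + c) = 0 := hx' s (Submodule.mem_sup_right hsS)
      have h2 : B s a = 0 := by rw [hs]; exact hC hsS a (hS ha)
      have h3 : B t c = 0 := hC hc t (hRT ht)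
      rw [map_add, h2, zero_add] at h1
      change B (s + t) c = 0
      rw [map_add, LinearMap.add_apply, h1, h3, add_zero]
    rw [LinearMap.BilinForm.orthogonal_orthogonal hB hrefl] at hc0
    rw [Submodule.disjoint_def.1 hSR a ha (key a (hS ha) ha0),
      Submodule.disjoint_def.1 hCR c hc (key c hc0 (hC hc)), add_zero]

/-- If `S ∩ C = 0`, `R ∩ L = 0` and `V = (S ⊕ C) ⊕ (R ⊕ L)`, the summands can be regrouped. -/
theorem isCompl_regroup {S R C L : Submodule ℝ V} (h1 : Disjoint S C) (h2 : Disjoint R L)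
    (h : IsCompl (S ⊔ C) (R ⊔ L)) :
    IsCompl (S ⊔ R) (L ⊔ C) ∧ IsCompl S (R ⊔ (L ⊔ C)) := by
  have htop : S ⊔ (R ⊔ (L ⊔ C)) = ⊤ := by
    rw [← h.sup_eq_top]; ac_rfl
  have hS : Disjoint S (R ⊔ (L ⊔ C)) := by
    have := h1.disjoint_sup_right_of_disjoint_sup_left h.disjoint
    rwa [show R ⊔ (L ⊔ C) = C ⊔ (R ⊔ L) by ac_rfl]
  have hR : Disjoint R (L ⊔ C) := by
    have := h2.disjoint_sup_right_of_disjoint_sup_left h.disjoint.symm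
    exact this.mono_right (sup_le_sup_left le_sup_right _)
  exact ⟨⟨hR.disjoint_sup_left_of_disjoint_sup_right hS, codisjoint_iff.2 (by rw [sup_assoc, htop])⟩,
    ⟨hS, codisjoint_iff.2 htop⟩⟩

end LinearAlgebra

/-! ### Indefinite Kähler manifolds -/

section Kahler

variable {F : Type*} [NormedAddCommGroup F] [NormedSpace ℝ F] [FiniteDimensional ℝ F]
  {N : Type*} [TopologicalSpace N] [ChartedSpace F N] [IsManifold 𝓘(ℝ, F) ∞ N]

instance instFiniteDimensionalTangentSpace (x : N) :
    FiniteDimensional ℝ (TangentSpace 𝓘(ℝ, F) x) :=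
  inferInstanceAs (FiniteDimensional ℝ F)

variable (F N) in
/-- An indefinite Kähler structure on the smooth manifold `N` modelled on `F`. -/
structure IndefiniteKahler where
  /-- the semi-Riemannian metric -/
  metric : ∀ x : N, TangentSpace 𝓘(ℝ, F) x →L[ℝ] TangentSpace 𝓘(ℝ, F) x →L[ℝ] ℝ
  contMDiff_metric : ContMDiff 𝓘(ℝ, F) (𝓘(ℝ, F).prod 𝓘(ℝ, F →L[ℝ] F →L[ℝ] ℝ)) ∞
    (fun x ↦ TotalSpace.mk' (F →L[ℝ] F →L[ℝ] ℝ) x (metric x))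
  metric_symm : ∀ (x : N) (u v : TangentSpace 𝓘(ℝ, F) x), metric x u v = metric x v u
  metric_nondegenerate : ∀ x : N, (metric x).toBilinForm.Nondegenerate
  /-- the constant index of the metric -/
  index : ℕ
  index_pos : 0 < index
  index_lt : index < finrank ℝ F
  hasIndex : ∀ x : N, HasIndex (metric x).toBilinForm index
  /-- the almost complex structure -/
  J : ∀ x : N, TangentSpace 𝓘(ℝ, F) x →L[ℝ] TangentSpace 𝓘(ℝ, F) x
  contMDiff_J : ContMDiff 𝓘(ℝ, F) (𝓘(ℝ, F).prod 𝓘(ℝ, F →L[ℝ] F)) ∞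
    (fun x ↦ TotalSpace.mk' (F →L[ℝ] F) x (J x))
  J_J : ∀ (x : N) (v : TangentSpace 𝓘(ℝ, F) x), J x (J x v) = -v
  metric_J_J : ∀ (x : N) (u v : TangentSpace 𝓘(ℝ, F) x), metric x (J x u) (J x v) = metric x u v
  /-- the Levi-Civita connection: `conn Y x u` is `∇_u Y` at `x` -/
  conn : CovariantDerivative 𝓘(ℝ, F) F (TangentSpace 𝓘(ℝ, F) : N → Type _)
  conn_torsion : conn.torsion = 0
  conn_metric : ∀ {x : N} {Y Z : ∀ y : N, TangentSpace 𝓘(ℝ, F) y},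
    MDiffAt (T% Y) x → MDiffAt (T% Z) x → ∀ u : TangentSpace 𝓘(ℝ, F) x,
      mvfderiv 𝓘(ℝ, F) (fun y ↦ metric y (Y y) (Z y)) x u =
        metric x (conn Y x u) (Z x) + metric x (Y x) (conn Z x u)
  /-- `J` is parallel -/
  conn_J : ∀ {x : N} {Y : ∀ y : N, TangentSpace 𝓘(ℝ, F) y}, MDiffAt (T% Y) x →
    ∀ u : TangentSpace 𝓘(ℝ, F) x, conn (fun y ↦ J y (Y y)) x u = J x (conn Y x u)

/-- The metric at a point, as a bilinear form. -/
def IndefiniteKahler.form (K : IndefiniteKahler F N) (x : N) :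
    LinearMap.BilinForm ℝ (TangentSpace 𝓘(ℝ, F) x) :=
  (K.metric x).toBilinForm

/-- The almost complex structure at a point, as a linear map. -/
def IndefiniteKahler.Jlin (K : IndefiniteKahler F N) (x : N) :
    TangentSpace 𝓘(ℝ, F) x →ₗ[ℝ] TangentSpace 𝓘(ℝ, F) x :=
  (K.J x).toLinearMap

end Kahler

/-! ### Vector fields along a map -/

section Along

variable {F : Type*} [NormedAddCommGroup F] [NormedSpace ℝ F] [FiniteDimensional ℝ F]
  {N : Type*} [TopologicalSpace N] [ChartedSpace F N] [IsManifold 𝓘(ℝ, F) ∞ N]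
  {E : Type*} [NormedAddCommGroup E] [NormedSpace ℝ E] [FiniteDimensional ℝ E]
  {M : Type*} [TopologicalSpace M] [ChartedSpace E M] [IsManifold 𝓘(ℝ, E) ∞ M]

variable (E) in
/-- `V` is a smooth section of `f*TN` on the set `U`. -/
def SmoothAlongOn (f : M → N) (V : ∀ p : M, TangentSpace 𝓘(ℝ, F) (f p)) (U : Set M) : Prop :=
  ContMDiffOn 𝓘(ℝ, E) (𝓘(ℝ, F).prod 𝓘(ℝ, F)) ∞
    (fun p ↦ (⟨f p, V p⟩ : TangentBundle 𝓘(ℝ, F) N)) U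

variable (E) in
/-- The family of subspaces `A p ⊆ T_{f p} N` is a smooth vector subbundle (of constant rank) of
`f*TN`. -/
def IsSubbundle (f : M → N) (A : ∀ p : M, Submodule ℝ (TangentSpace 𝓘(ℝ, F) (f p))) : Prop :=
  ∃ k : ℕ, ∀ p : M, ∃ U : Set M, IsOpen U ∧ p ∈ U ∧
    ∃ s : Fin k → ∀ q : M, TangentSpace 𝓘(ℝ, F) (f q),
      (∀ i, SmoothAlongOn E f (s i) U) ∧
      ∀ q ∈ U, LinearIndependent ℝ (fun i ↦ s i q) ∧ Submodule.span ℝ (Set.range fun i ↦ s i q) = A q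

/-- The vector field around `x` with constant coordinates `c` in the standard trivialization of `TN`
at `x`. -/
def constField (x : N) (c : F) : ∀ y : N, TangentSpace 𝓘(ℝ, F) y :=
  fun y ↦ (trivializationAt F (TangentSpace 𝓘(ℝ, F) : N → Type _) x).symmL ℝ y c

/-- The coordinates of a tangent vector at `y`, for `y` near `x`, in the standard trivialization of
`TN` at `x`. -/
def coords (x y : N) : TangentSpace 𝓘(ℝ, F) y →L[ℝ] F :=
  (trivializationAt F (TangentSpace 𝓘(ℝ, F) : N → Type _) x).continuousLinearMapAt ℝ y

/-- The covariant derivative `∇̄_x V ∈ T_{f p} N` of a section `V` of `f*TN` in the direction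
`x ∈ T_p M`, induced by the Levi-Civita connection of `N`. In a local frame `(Eᵢ)` of `TN`
around `f p` with `V = ∑ Vⁱ Eᵢ ∘ f`, it is `∑ dVⁱ(x) Eᵢ + Vⁱ(p) ∇_{df x} Eᵢ`; the second
part is the derivative of the vector field that has the constant coordinates `Vⁱ(p)`. -/
def covAlong (K : IndefiniteKahler F N) (f : M → N) (V : ∀ p : M, TangentSpace 𝓘(ℝ, F) (f p))
    (p : M) : TangentSpace 𝓘(ℝ, E) p →L[ℝ] TangentSpace 𝓘(ℝ, F) (f p) :=
  (trivializationAt F (TangentSpace 𝓘(ℝ, F) : N → Type _) (f p)).symmL ℝ (f p) ∘L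
      mvfderiv 𝓘(ℝ, E) (fun q ↦ coords (f p) (f q) (V q)) p +
    K.conn (constField (f p) (coords (f p) (f p) (V p))) (f p) ∘L mfderiv 𝓘(ℝ, E) 𝓘(ℝ, F) f p

section Leibniz

set_option linter.unusedSectionVars false

theorem mdifferentiableAt_constField (x : N) (c : F) : MDiffAt (T% (constField x c)) x := by
  rw [mdifferentiableAt_section]
  set e := trivializationAt F (TangentSpace 𝓘(ℝ, F) : N → Type _) x with he
  have : MDiffAt (fun _ : N ↦ c) x := mdifferentiableAt_const
  refine this.congr_of_eventuallyEq ?_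
  filter_upwards [e.open_baseSet.mem_nhds (FiberBundle.mem_baseSet_trivializationAt F _ x)] with y hy
  simp only [constField]
  rw [Trivialization.symmL_apply _ hy, e.apply_mk_symm hy]

variable (K : IndefiniteKahler F N)

theorem conn_constField_add (x : N) (c c' : F) :
    K.conn (constField x (c + c')) x = K.conn (constField x c) x + K.conn (constField x c') x := by
  rw [← K.conn.isCovariantDerivativeOnUniv.add (mdifferentiableAt_constField x c)
    (mdifferentiableAt_constField x c')]
  congr 1
  funext y
  simp [constField]

theorem conn_constField_smul (x : N) (a : ℝ) (c : F) :
    K.conn (constField x (a • c)) x = a • K.conn (constField x c) x := by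
  rw [← K.conn.isCovariantDerivativeOnUniv.smul_const a (mdifferentiableAt_constField x c)]
  congr 1
  funext y
  simp [constField]

variable {f : M → N} {p : M} {V W : ∀ p : M, TangentSpace 𝓘(ℝ, F) (f p)}

theorem mdifferentiableAt_coords
    (hV : MDiffAt (fun q ↦ (⟨f q, V q⟩ : TangentBundle 𝓘(ℝ, F) N)) p) :
    MDiffAt (fun q ↦ coords (f p) (f q) (V q)) p := by
  rw [mdifferentiableAt_totalSpace] at hV
  refine hV.2.congr_of_eventuallyEq ?_
  set e := trivializationAt F (TangentSpace 𝓘(ℝ, F) : N → Type _) (f p) with he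
  have h1 : ∀ᶠ y in nhds (f p), y ∈ e.baseSet :=
    e.open_baseSet.mem_nhds (FiberBundle.mem_baseSet_trivializationAt F _ (f p))
  filter_upwards [hV.1.continuousAt.eventually h1] with q hq
  simp only [coords]
  rw [Trivialization.continuousLinearMapAt_apply, Trivialization.coe_linearMapAt_of_mem _ hq]

theorem covAlong_add (hV : MDiffAt (fun q ↦ (⟨f q, V q⟩ : TangentBundle 𝓘(ℝ, F) N)) p)
    (hW : MDiffAt (fun q ↦ (⟨f q, W q⟩ : TangentBundle 𝓘(ℝ, F) N)) p) :
    covAlong K f (fun q ↦ V q + W q) p = covAlong (E := E) K f V p + covAlong K f W p := by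
  ext x
  simp only [covAlong, map_add, conn_constField_add]
  rw [mvfderiv_fun_add (mdifferentiableAt_coords hV) (mdifferentiableAt_coords hW)]
  simp
  abel

theorem covAlong_smul {a : M → ℝ} (ha : MDiffAt a p)
    (hV : MDiffAt (fun q ↦ (⟨f q, V q⟩ : TangentBundle 𝓘(ℝ, F) N)) p)
    (x : TangentSpace 𝓘(ℝ, E) p) :
    covAlong K f (fun q ↦ a q • V q) p x =
      a p • covAlong K f V p x + mvfderiv 𝓘(ℝ, E) a p x • V p := by
  simp only [covAlong, map_smul, conn_constField_smul]
  rw [mvfderiv_fun_smul ha (mdifferentiableAt_coords hV)]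
  have : (trivializationAt F (TangentSpace 𝓘(ℝ, F) : N → Type _) (f p)).symmL ℝ (f p)
      (coords (f p) (f p) (V p)) = V p :=
    Trivialization.symmL_continuousLinearMapAt _
      (FiberBundle.mem_baseSet_trivializationAt F _ (f p)) _
  simp [this]
  module

end Leibniz

variable (E) in
/-- The tangent space `df(T_p M)` of the submanifold, in `T_{f p} N`. -/
def tangentImage (f : M → N) (p : M) : Submodule ℝ (TangentSpace 𝓘(ℝ, F) (f p)) :=
  LinearMap.range (mfderiv 𝓘(ℝ, E) 𝓘(ℝ, F) f p).toLinearMap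

variable (E) in
/-- The normal space `TM^⊥` at `p`. -/
def normalSpace (K : IndefiniteKahler F N) (f : M → N) (p : M) :
    Submodule ℝ (TangentSpace 𝓘(ℝ, F) (f p)) :=
  (K.form (f p)).orthogonal (tangentImage E f p)

variable (E) in
/-- The radical space `Rad(TM) = TM ∩ TM^⊥` at `p`. -/
def radical (K : IndefiniteKahler F N) (f : M → N) (p : M) :
    Submodule ℝ (TangentSpace 𝓘(ℝ, F) (f p)) :=
  tangentImage E f p ⊓ normalSpace E K f p

/-- The induced (degenerate) metric on `M`. -/
def inducedForm (K : IndefiniteKahler F N) (f : M → N) (p : M) :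
    LinearMap.BilinForm ℝ (TangentSpace 𝓘(ℝ, E) p) :=
  (K.form (f p)).compl₁₂ (mfderiv 𝓘(ℝ, E) 𝓘(ℝ, F) f p).toLinearMap
    (mfderiv 𝓘(ℝ, E) 𝓘(ℝ, F) f p).toLinearMap

end Along

/-! ### Lightlike submanifolds -/

section Lightlike

variable {F : Type*} [NormedAddCommGroup F] [NormedSpace ℝ F] [FiniteDimensional ℝ F]
  {N : Type*} [TopologicalSpace N] [ChartedSpace F N] [IsManifold 𝓘(ℝ, F) ∞ N]

/-- A lightlike submanifold `(M, g, S(TM), S(TM^⊥), ltr(TM))` of an indefinite Kähler manifold: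
a smooth immersion for which `Rad(TM)` has constant rank `r ≥ 1`, with a chosen screen
distribution, screen transversal bundle and lightlike transversal bundle. All bundles are regarded
as subbundles of the restriction of the ambient tangent bundle to `M`. -/
structure LightlikeSubmanifold (K : IndefiniteKahler F N)
    (E : Type*) [NormedAddCommGroup E] [NormedSpace ℝ E] [FiniteDimensional ℝ E]
    (M : Type*) [TopologicalSpace M] [ChartedSpace E M] [IsManifold 𝓘(ℝ, E) ∞ M] where
  /-- the immersion -/
  toFun : M → N
  contMDiff : ContMDiff 𝓘(ℝ, E) 𝓘(ℝ, F) ∞ toFun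
  injective_mfderiv : ∀ p, Function.Injective (mfderiv 𝓘(ℝ, E) 𝓘(ℝ, F) toFun p)
  /-- the rank of the radical distribution -/
  r : ℕ
  r_pos : 1 ≤ r
  finrank_radical : ∀ p, finrank ℝ (radical E K toFun p) = r
  /-- the screen distribution `S(TM)` -/
  screen : ∀ p, Submodule ℝ (TangentSpace 𝓘(ℝ, F) (toFun p))
  screen_subbundle : IsSubbundle E toFun screen
  screen_disjoint : ∀ p, Disjoint (screen p) (radical E K toFun p)
  screen_sup : ∀ p, screen p ⊔ radical E K toFun p = tangentImage E toFun p
  /-- the screen transversal bundle `S(TM^⊥)` -/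
  coscreen : ∀ p, Submodule ℝ (TangentSpace 𝓘(ℝ, F) (toFun p))
  coscreen_subbundle : IsSubbundle E toFun coscreen
  coscreen_disjoint : ∀ p, Disjoint (coscreen p) (radical E K toFun p)
  coscreen_sup : ∀ p, coscreen p ⊔ radical E K toFun p = normalSpace E K toFun p
  /-- the lightlike transversal bundle `ltr(TM)`: a complement of `Rad(TM)` in the orthogonal
  complement of `S(TM) ⊥ S(TM^⊥)` which is totally null; equivalently, locally it has a frame
  `(Nⱼ)` with `ḡ(ξᵢ, Nⱼ) = δᵢⱼ` and `ḡ(Nᵢ, Nⱼ) = 0` for a frame `(ξᵢ)` of `Rad(TM)` -/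
  ltr : ∀ p, Submodule ℝ (TangentSpace 𝓘(ℝ, F) (toFun p))
  ltr_subbundle : IsSubbundle E toFun ltr
  ltr_disjoint : ∀ p, Disjoint (radical E K toFun p) (ltr p)
  ltr_sup : ∀ p, radical E K toFun p ⊔ ltr p =
    (K.form (toFun p)).orthogonal (screen p ⊔ coscreen p)
  ltr_null : ∀ p, ∀ u ∈ ltr p, ∀ v ∈ ltr p, K.metric (toFun p) u v = 0

namespace LightlikeSubmanifold

variable {K : IndefiniteKahler F N}
  {E : Type*} [NormedAddCommGroup E] [NormedSpace ℝ E] [FiniteDimensional ℝ E]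
  {M : Type*} [TopologicalSpace M] [ChartedSpace E M] [IsManifold 𝓘(ℝ, E) ∞ M]
  (L : LightlikeSubmanifold K E M)

/-- The ambient tangent space at the image of a point. -/
abbrev Ambient (p : M) : Type _ := TangentSpace 𝓘(ℝ, F) (L.toFun p)

/-- The tangent space of the submanifold, as a subspace of the ambient one. -/
abbrev tan (p : M) : Submodule ℝ (L.Ambient p) := tangentImage E L.toFun p

/-- The radical space at a point. -/
abbrev rad (p : M) : Submodule ℝ (L.Ambient p) := radical E K L.toFun p

/-- The transversal space `tr(TM) = ltr(TM) ⊥ S(TM^⊥)`. -/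
def tr (p : M) : Submodule ℝ (L.Ambient p) := L.ltr p ⊔ L.coscreen p

/-- The differential of the immersion. -/
def d (p : M) : TangentSpace 𝓘(ℝ, E) p →ₗ[ℝ] L.Ambient p :=
  (mfderiv 𝓘(ℝ, E) 𝓘(ℝ, F) L.toFun p).toLinearMap

/-- The induced metric on `M`. -/
def g (p : M) : LinearMap.BilinForm ℝ (TangentSpace 𝓘(ℝ, E) p) := inducedForm K L.toFun p

theorem isCompl_aux (p : M) : Disjoint (L.screen p) (L.coscreen p) ∧
    IsCompl (L.screen p ⊔ L.coscreen p) (L.rad p ⊔ L.ltr p) :=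
  isCompl_splitting (K.metric_nondegenerate _) (K.metric_symm _) rfl (L.screen_disjoint p)
    (L.screen_sup p) (L.coscreen_disjoint p) (L.coscreen_sup p) (L.ltr_sup p)

/-- `TN|_M = TM ⊕ tr(TM)`. -/
theorem isCompl_tan_tr (p : M) : IsCompl (L.tan p) (L.tr p) := by
  have := (isCompl_regroup (L.isCompl_aux p).1 (L.ltr_disjoint p) (L.isCompl_aux p).2).1
  rwa [L.screen_sup p] at this

/-- `TN|_M = S(TM) ⊕ (Rad(TM) ⊕ tr(TM))`. -/
theorem isCompl_screen (p : M) : IsCompl (L.screen p) (L.rad p ⊔ L.tr p) :=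
  (isCompl_regroup (L.isCompl_aux p).1 (L.ltr_disjoint p) (L.isCompl_aux p).2).2

/-- `TN|_M = S(TM^⊥) ⊕ (ltr(TM) ⊕ TM)`. -/
theorem isCompl_coscreen (p : M) : IsCompl (L.coscreen p) (L.ltr p ⊔ L.tan p) := by
  have := (isCompl_regroup (L.isCompl_aux p).1.symm (L.ltr_disjoint p).symm
    (by rw [sup_comm, sup_comm (L.ltr p)]; exact (L.isCompl_aux p).2)).2
  rwa [sup_comm (L.rad p), L.screen_sup p] at this

/-- The projection of the ambient tangent space onto `TM` along `tr(TM)`. -/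
def projTan (p : M) : L.Ambient p →ₗ[ℝ] L.Ambient p :=
  (L.tan p).projection (L.tr p) (L.isCompl_tan_tr p)

/-- The projection of the ambient tangent space onto `tr(TM)` along `TM`. -/
def projTr (p : M) : L.Ambient p →ₗ[ℝ] L.Ambient p :=
  (L.tr p).projection (L.tan p) (L.isCompl_tan_tr p).symm

/-- The projection of the ambient tangent space onto `S(TM)` along `Rad(TM) ⊕ tr(TM)`. -/
def projScreen (p : M) : L.Ambient p →ₗ[ℝ] L.Ambient p :=
  (L.screen p).projection (L.rad p ⊔ L.tr p) (L.isCompl_screen p)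

/-- The projection of the ambient tangent space onto `S(TM^⊥)` along `ltr(TM) ⊕ TM`. -/
def projCoscreen (p : M) : L.Ambient p →ₗ[ℝ] L.Ambient p :=
  (L.coscreen p).projection (L.ltr p ⊔ L.tan p) (L.isCompl_coscreen p)

theorem projTr_d (p : M) (x : TangentSpace 𝓘(ℝ, E) p) : L.projTr p (L.d p x) = 0 :=
  (Submodule.projection_apply_eq_zero_iff _).2 ⟨x, rfl⟩

theorem mdifferentiableAt_d {p : M} {Y : ∀ q : M, TangentSpace 𝓘(ℝ, E) q} (hY : MDiffAt (T% Y) p) :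
    MDiffAt (fun q ↦ (⟨L.toFun q, L.d q (Y q)⟩ : TangentBundle 𝓘(ℝ, F) N)) p :=
  ((L.contMDiff.contMDiff_tangentMap (m := 1) (by rw [one_add_one_eq_two]; exact ENat.LEInfty.out)).mdifferentiable one_ne_zero
    (T% Y p)).comp p hY

theorem tensorialAt_projTr_covAlong (p : M) (x : TangentSpace 𝓘(ℝ, E) p) :
    TensorialAt 𝓘(ℝ, E) E (fun Y : ∀ q : M, TangentSpace 𝓘(ℝ, E) q ↦
      L.projTr p (covAlong K L.toFun (fun q ↦ L.d q (Y q)) p x)) p where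
  smul {a Y} ha hY := by
    have := covAlong_smul K ha (L.mdifferentiableAt_d hY) x
    simp only [Pi.smul_apply', map_smul, this, map_add, projTr_d, smul_zero, add_zero]
  add hY hZ := by
    simp only [Pi.add_apply, map_add,
      covAlong_add K (L.mdifferentiableAt_d hY) (L.mdifferentiableAt_d hZ), add_apply]

/-- The second fundamental form `h` at `p`: `h(x, y)` is the `tr(TM)`-part of `∇̄_x Y` for any
vector field `Y` on `M` with `Y p = y` (see `h_apply`; here a standard local extension of `y`). -/
def h (p : M) : TangentSpace 𝓘(ℝ, E) p →ₗ[ℝ] TangentSpace 𝓘(ℝ, E) p →ₗ[ℝ] L.Ambient p :=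
  LinearMap.mk₂ ℝ (fun x y ↦ TensorialAt.mkHom _ p (L.tensorialAt_projTr_covAlong p x) y)
    (fun x x' y ↦ by simp [TensorialAt.mkHom_apply_eq_extend])
    (fun c x y ↦ by simp [TensorialAt.mkHom_apply_eq_extend])
    (fun x y y' ↦ map_add _ y y')
    (fun c x y ↦ map_smul _ c y)

/-- `h(X, Y)` is the `tr(TM)`-part of `∇̄_X Y` for every vector field `Y` on `M`. -/
theorem h_apply {p : M} {Y : ∀ q : M, TangentSpace 𝓘(ℝ, E) q} (hY : MDiffAt (T% Y) p)
    (x : TangentSpace 𝓘(ℝ, E) p) :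
    L.h p x (Y p) = L.projTr p (covAlong K L.toFun (fun q ↦ L.d q (Y q)) p x) :=
  TensorialAt.mkHom_apply (L.tensorialAt_projTr_covAlong p x) hY

/-- The shape operator `A_W` at `p` of a section `W` of `tr(TM)`: `A_W x` is minus the tangential
part of `∇̄_x W`, regarded as a vector of the ambient tangent space. -/
def shapeOperator (W : ∀ q : M, L.Ambient q) (p : M) :
    TangentSpace 𝓘(ℝ, E) p →ₗ[ℝ] L.Ambient p :=
  -(L.projTan p ∘ₗ (covAlong K L.toFun W p).toLinearMap)

/-- The operator `A*_ξ` at `p` of a section `ξ` of `Rad(TM)`: `A*_ξ x` is minus the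
`S(TM)`-part of `∇_x ξ`, where the induced derivative `∇_x ξ` is the tangential part of `∇̄_x ξ`. -/
def screenShapeOperator (ξ : ∀ q : M, L.Ambient q) (p : M) :
    TangentSpace 𝓘(ℝ, E) p →ₗ[ℝ] L.Ambient p :=
  -(L.projScreen p ∘ₗ L.projTan p ∘ₗ (covAlong K L.toFun ξ p).toLinearMap)

/-- The trace over a nondegenerate subspace `B` of the tangent space of an operator `A` with
values in the tangent space: `∑ᵢ εᵢ g(A eᵢ, eᵢ)` for an orthonormal basis `(eᵢ)` of `B`. -/
def traceOn (p : M) (B : Submodule ℝ (L.Ambient p))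
    (A : TangentSpace 𝓘(ℝ, E) p →ₗ[ℝ] L.Ambient p) : ℝ :=
  metricTrace (L.g p) (B.comap (L.d p)) ((K.form (L.toFun p)).compl₁₂ A (L.d p))

/-- `M` is totally umbilical: `h(X, Y) = g(X, Y) H` for a smooth section `H` of `tr(TM)`. -/
def IsTotallyUmbilical : Prop :=
  ∃ H : ∀ p : M, L.Ambient p, SmoothAlongOn E L.toFun H Set.univ ∧ (∀ p, H p ∈ L.tr p) ∧
    ∀ (p : M) (x y : TangentSpace 𝓘(ℝ, E) p), L.h p x y = L.g p x y • H p

/-- `M` is minimal in the sense of Bejan and Duggal: the `S(TM^⊥)`-part `hˢ` of `h` vanishes on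
`Rad(TM)`, and the trace of `h` with respect to `g` restricted to `S(TM)` vanishes. -/
def IsMinimal : Prop :=
  (∀ (p : M) (x y : TangentSpace 𝓘(ℝ, E) p), L.d p x ∈ L.rad p → L.d p y ∈ L.rad p →
    L.projCoscreen p (L.h p x y) = 0) ∧
  ∀ p : M, metricTrace (L.g p) ((L.screen p).comap (L.d p)) (L.h p) = 0

/-- The image `J̄(A)` of a subspace of an ambient tangent space. -/
def imageJ {p : M} (A : Submodule ℝ (L.Ambient p)) : Submodule ℝ (L.Ambient p) :=
  A.map (K.Jlin (L.toFun p))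

/-- The distributions that make a lightlike submanifold a screen transversal Cauchy Riemann (STCR)
lightlike submanifold: `Rad(TM) = D₁ ⊕ D₂` with `J̄ D₁ ⊆ S(TM)` and `J̄ D₂ ⊆ S(TM^⊥)`, and
`S(TM) = (J̄ D₁ ⊕ D') ⊥ D₀` with `J̄ D₀ = D₀` nondegenerate and `J̄ D' = L₁ ⊥ S`, where
`L₁ ⊆ ltr(TM)` and `S ⊆ S(TM^⊥)`. -/
structure STCR where
  D₁ : ∀ p : M, Submodule ℝ (L.Ambient p)
  D₂ : ∀ p : M, Submodule ℝ (L.Ambient p)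
  D₀ : ∀ p : M, Submodule ℝ (L.Ambient p)
  D' : ∀ p : M, Submodule ℝ (L.Ambient p)
  L₁ : ∀ p : M, Submodule ℝ (L.Ambient p)
  S : ∀ p : M, Submodule ℝ (L.Ambient p)
  D₁_subbundle : IsSubbundle E L.toFun D₁
  D₂_subbundle : IsSubbundle E L.toFun D₂
  D₀_subbundle : IsSubbundle E L.toFun D₀
  D'_subbundle : IsSubbundle E L.toFun D'
  L₁_subbundle : IsSubbundle E L.toFun L₁
  S_subbundle : IsSubbundle E L.toFun S
  rad_disjoint : ∀ p, Disjoint (D₁ p) (D₂ p)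
  rad_eq : ∀ p, L.rad p = D₁ p ⊔ D₂ p
  J_D₁_le : ∀ p, L.imageJ (D₁ p) ≤ L.screen p
  J_D₂_le : ∀ p, L.imageJ (D₂ p) ≤ L.coscreen p
  screen_disjoint : ∀ p, Disjoint (L.imageJ (D₁ p)) (D' p) ∧
    Disjoint (L.imageJ (D₁ p) ⊔ D' p) (D₀ p)
  screen_eq : ∀ p, L.screen p = (L.imageJ (D₁ p) ⊔ D' p) ⊔ D₀ p
  screen_orthogonal : ∀ p, ∀ u ∈ L.imageJ (D₁ p) ⊔ D' p, ∀ v ∈ D₀ p, K.metric (L.toFun p) u v = 0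
  J_D₀ : ∀ p, L.imageJ (D₀ p) = D₀ p
  D₀_nondegenerate : ∀ p, ∀ u ∈ D₀ p, (∀ v ∈ D₀ p, K.metric (L.toFun p) u v = 0) → u = 0
  L₁_le : ∀ p, L₁ p ≤ L.ltr p
  S_le : ∀ p, S p ≤ L.coscreen p
  J_D'_disjoint : ∀ p, Disjoint (L₁ p) (S p)
  J_D'_eq : ∀ p, L.imageJ (D' p) = L₁ p ⊔ S p

/-- The distribution `D₀ ⊥ J̄(S)`. -/
def STCR.D₀JS {L : LightlikeSubmanifold K E M} (C : L.STCR) (p : M) : Submodule ℝ (L.Ambient p) :=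
  C.D₀ p ⊔ L.imageJ (C.S p)

end LightlikeSubmanifold

end Lightlike

end LightlikeGeometry

/-! Write B for D₀ ⊥ J̄(S). Since h = g·H, the trace of h over a nondegenerate subspace A of TM is
dim(A)·H. The condition on hˢ holds automatically, because g vanishes on Rad(TM). So minimality says
that at every point S(TM) = 0 or H = 0 (`hmin`).

For a section W of TM^⊥, differentiating ḡ(W, Y) = 0 gives the Weingarten formula ḡ(∇̄_X W, Y) =
-ḡ(W, h(X, Y)) (`metric_covAlong_normal`, from metricity of the derivative along the immersion,
`mvfderiv_metric_along`). The projections defining A_W and A*_ξ do not affect pairings with screen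
vectors, so the two traces over B are dim(B)·ḡ(W, H) and dim(B)·ḡ(ξ, H).

If S(TM) = 0 then B = 0, so minimality makes the traces vanish. Conversely, where B ≠ 0, vanishing
traces make H orthogonal to S(TM^⊥) and Rad(TM), and a transversal vector with this property is zero
(`eq_zero_of_mem_tr`). Where B = 0, the assumption gives D₁ = 0. Then S(TM) = J̄(L₁) is both totally
null and nondegenerate, hence zero (`STCR.screen_eq_bot`). -/

namespace LightlikeGeometry

/-! ### Product rule for a varying bilinear form -/

section

variable {E : Type*} [NormedAddCommGroup E] [NormedSpace ℝ E]
  {M : Type*} [TopologicalSpace M] [ChartedSpace E M]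
  {F : Type*} [NormedAddCommGroup F] [NormedSpace ℝ F]

/-- The Leibniz rule in three factors. The term that differentiates `G` is written with `v` and `w`
frozen at `p`, so that it can later be computed on the ambient manifold by the chain rule. -/
theorem mvfderiv_bilin_apply {p : M} {G : M → F →L[ℝ] F →L[ℝ] ℝ} {v w : M → F}
    (hG : MDiffAt G p) (hv : MDiffAt v p) (hw : MDiffAt w p) (x : TangentSpace 𝓘(ℝ, E) p) :
    mvfderiv 𝓘(ℝ, E) (fun q ↦ G q (v q) (w q)) p x =
      mvfderiv 𝓘(ℝ, E) (fun q ↦ G q (v p) (w p)) p x +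
        G p (mvfderiv 𝓘(ℝ, E) v p x) (w p) + G p (v p) (mvfderiv 𝓘(ℝ, E) w p x) := by
  have h1 : MDiffAt (fun q ↦ G q (v q) (w q)) p := (hG.clm_apply hv).clm_apply hw
  have h2 : MDiffAt (fun q ↦ G q (v p) (w p)) p :=
    (hG.clm_apply mdifferentiableAt_const).clm_apply mdifferentiableAt_const
  rw [h1.mvfderiv, h2.mvfderiv, hv.mvfderiv, hw.mvfderiv]
  have dG := hG.differentiableWithinAt_writtenInExtChartAt
  have dv := hv.differentiableWithinAt_writtenInExtChartAt
  have dw := hw.differentiableWithinAt_writtenInExtChartAt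
  have key := ((dG.hasFDerivWithinAt.clm_apply dv.hasFDerivWithinAt).clm_apply
    dw.hasFDerivWithinAt)
  have key2 := ((dG.hasFDerivWithinAt.clm_apply (hasFDerivWithinAt_const (v p) _ _)).clm_apply
    (hasFDerivWithinAt_const (w p) _ _))
  have hu : UniqueDiffWithinAt ℝ (Set.range 𝓘(ℝ, E)) (extChartAt 𝓘(ℝ, E) p p) := by
    simp
  have e1 := key.fderivWithin hu
  have e2 := key2.fderivWithin hu
  -- The charts of the target vector spaces are identities, so the chart expression of the pairing
  -- is by definition the pairing of the chart expressions.
  have a1 : fderivWithin ℝ (writtenInExtChartAt 𝓘(ℝ, E) 𝓘(ℝ, ℝ) p fun q ↦ G q (v q) (w q))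
     (Set.range 𝓘(ℝ, E)) (extChartAt 𝓘(ℝ, E) p p) = _ := e1
  have a2 : fderivWithin ℝ (writtenInExtChartAt 𝓘(ℝ, E) 𝓘(ℝ, ℝ) p fun q ↦ G q (v p) (w p))
     (Set.range 𝓘(ℝ, E)) (extChartAt 𝓘(ℝ, E) p p) = _ := e2
  rw [a1, a2]
  simp only [writtenInExtChartAt, extChartAt_model_space_eq_id, PartialEquiv.refl_coe,
    Function.id_comp, Function.comp_apply, extChartAt_to_inv, ContinuousLinearMap.comp_zero,
    zero_add]
  have comm3 : ∀ a b c : ℝ, a + (b + c) = c + b + a := fun a b c ↦ by ring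
  exact comm3 _ _ _

end

/-! ### Metricity of the covariant derivative along a map -/

section

variable {F : Type*} [NormedAddCommGroup F] [NormedSpace ℝ F] [FiniteDimensional ℝ F]
  {N : Type*} [TopologicalSpace N] [ChartedSpace F N] [IsManifold 𝓘(ℝ, F) ∞ N]
  {E : Type*} [NormedAddCommGroup E] [NormedSpace ℝ E] [FiniteDimensional ℝ E]
  {M : Type*} [TopologicalSpace M] [ChartedSpace E M] [IsManifold 𝓘(ℝ, E) ∞ M]

omit [FiniteDimensional ℝ F] in
theorem constField_coords {x y : N}
    (hy : y ∈ (trivializationAt F (TangentSpace 𝓘(ℝ, F) : N → Type _) x).baseSet)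
    (v : TangentSpace 𝓘(ℝ, F) y) : constField x (coords x y v) y = v :=
  Trivialization.symmL_continuousLinearMapAt _ hy _

variable (K : IndefiniteKahler F N)

/-- The metric in the standard trivialization of the tangent bundle at `x`. -/
def metricCoords (x y : N) : F →L[ℝ] F →L[ℝ] ℝ :=
  let e := (trivializationAt F (TangentSpace 𝓘(ℝ, F) : N → Type _) x).symmL ℝ y
  ContinuousLinearMap.precomp ℝ e ∘L K.metric y ∘L e

theorem metricCoords_apply (x y : N) (c c' : F) :
    metricCoords K x y c c' = K.metric y (constField x c y) (constField x c' y) := rfl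

/-- Smoothness of the metric as a section of the Hom bundle is smoothness of its coordinate
expression, which agrees with `metricCoords` on the base set of the trivialization at `x`. -/
theorem mdifferentiableAt_metricCoords (x : N) : MDiffAt (metricCoords K x) x := by
  have h := ((contMDiffAt_hom_bundle _).1 (K.contMDiff_metric x)).2.mdifferentiableAt (by simp)
  refine h.congr_of_eventuallyEq ?_
  set e := trivializationAt F (TangentSpace 𝓘(ℝ, F) : N → Type _) x with he
  filter_upwards [e.open_baseSet.mem_nhds (FiberBundle.mem_baseSet_trivializationAt F _ x)] with y hy
  ext c c'
  rw [inCoordinates_apply_eq₂ hy hy (Set.mem_univ _)]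
  simp [metricCoords_apply, constField, ← he, Trivialization.symmL_apply _ hy]

variable {f : M → N} {p : M} {V W : ∀ p : M, TangentSpace 𝓘(ℝ, F) (f p)}

/-- The covariant derivative along a map is metric. -/
theorem mvfderiv_metric_along (hV : MDiffAt (fun q ↦ (⟨f q, V q⟩ : TangentBundle 𝓘(ℝ, F) N)) p)
    (hW : MDiffAt (fun q ↦ (⟨f q, W q⟩ : TangentBundle 𝓘(ℝ, F) N)) p)
    (x : TangentSpace 𝓘(ℝ, E) p) :
    mvfderiv 𝓘(ℝ, E) (fun q ↦ K.metric (f q) (V q) (W q)) p x =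
      K.metric (f p) (covAlong K f V p x) (W p) + K.metric (f p) (V p) (covAlong K f W p x) := by
  set e := trivializationAt F (TangentSpace 𝓘(ℝ, F) : N → Type _) (f p) with he
  have hp : f p ∈ e.baseSet := FiberBundle.mem_baseSet_trivializationAt F _ (f p)
  have hf : MDiffAt f p := ((mdifferentiableAt_totalSpace _ _).1 hV).1
  have hG : MDiffAt (metricCoords K (f p)) (f p) := mdifferentiableAt_metricCoords K (f p)
  have heq : (fun q ↦ K.metric (f q) (V q) (W q)) =ᶠ[nhds p]
      fun q ↦ metricCoords K (f p) (f q) (coords (f p) (f q) (V q)) (coords (f p) (f q) (W q)) := by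
    filter_upwards [hf.continuousAt.eventually (e.open_baseSet.mem_nhds hp)] with q hq
    rw [metricCoords_apply, constField_coords hq, constField_coords hq]
  have h1 : mvfderiv 𝓘(ℝ, E) (fun q ↦ K.metric (f q) (V q) (W q)) p = mvfderiv 𝓘(ℝ, E)
      (fun q ↦ metricCoords K (f p) (f q) (coords (f p) (f q) (V q))
        (coords (f p) (f q) (W q))) p := by
    simp only [mvfderiv, heq.mfderiv_eq]
    rfl
  have hGf : MDiffAt (fun q ↦ metricCoords K (f p) (f q)) p := hG.comp p hf
  rw [h1, mvfderiv_bilin_apply hGf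
    (mdifferentiableAt_coords hV) (mdifferentiableAt_coords hW)]
  set v := coords (f p) (f p) (V p) with hv
  set w := coords (f p) (f p) (W p) with hw
  -- The frozen coefficients are the pairing of two constant-coordinate fields on `N`. `conn_metric`
  -- differentiates it, which yields exactly the connection terms of `covAlong`.
  have h2 : mvfderiv 𝓘(ℝ, E) (fun q ↦ metricCoords K (f p) (f q) v w) p x =
      mvfderiv 𝓘(ℝ, F) (fun y ↦ metricCoords K (f p) y v w) (f p)
        (mfderiv 𝓘(ℝ, E) 𝓘(ℝ, F) f p x) :=
    mvfderiv_comp_apply p ((hG.clm_apply mdifferentiableAt_const).clm_apply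
      mdifferentiableAt_const) hf x
  rw [h2]
  simp only [metricCoords_apply]
  rw [K.conn_metric (mdifferentiableAt_constField _ _) (mdifferentiableAt_constField _ _),
    hv, hw, constField_coords hp, constField_coords hp]
  simp only [covAlong, add_apply, map_add, ContinuousLinearMap.comp_apply]
  simp only [constField]
  abel

end

/-- The Gram matrix contracted with its inverse is the trace of the identity, so no orthonormal
basis is needed. -/
theorem metricTrace_eq_finrank_smul {V : Type*} [AddCommGroup V] [Module ℝ V]
    [FiniteDimensional ℝ V] {U : Type*} [AddCommGroup U] [Module ℝ U]
    {B : LinearMap.BilinForm ℝ V} (hs : ∀ u v, B u v = B v u) {A : Submodule ℝ V}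
    (hA : ∀ u ∈ A, (∀ v ∈ A, B u v = 0) → u = 0) {T : V →ₗ[ℝ] V →ₗ[ℝ] U} {H : U}
    (hT : ∀ u ∈ A, ∀ v ∈ A, T u v = B u v • H) :
    metricTrace B A T = (finrank ℝ A : ℝ) • H := by
  set b := finBasis ℝ A with hb
  set G : Matrix (Fin (finrank ℝ A)) (Fin (finrank ℝ A)) ℝ :=
    Matrix.of fun i j ↦ B (b i : V) (b j : V) with hG
  -- A kernel vector of the Gram matrix gives a combination of the basis orthogonal to all of `A`;
  -- nondegeneracy and linear independence make it trivial.
  have hdet : G.det ≠ 0 := by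
    intro h
    obtain ⟨c, hc, hGc⟩ := Matrix.exists_mulVec_eq_zero_iff.2 h
    have hu : ∑ j, c j • b j = 0 := by
      refine Subtype.ext (hA _ (Subtype.property _) fun v hv ↦ ?_)
      have hbu : ∀ i, B (b i : V) ((∑ j, c j • b j : A) : V) = 0 := fun i ↦ by
        have := congrFun hGc i
        simp only [Matrix.mulVec, dotProduct, hG, Matrix.of_apply, Pi.zero_apply] at this
        simpa [mul_comm] using this
      rw [hs, ← Submodule.coe_mk v hv, ← b.sum_repr ⟨v, hv⟩]
      rw [AddSubmonoidClass.coe_finsetSum]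
      simp only [map_sum, LinearMap.sum_apply, Submodule.coe_smul, map_smul, LinearMap.smul_apply,
        hbu, smul_zero, Finset.sum_const_zero]
    exact hc (funext (Fintype.linearIndependent_iff.1 b.linearIndependent c hu))
  have hGt : G.transpose = G := Matrix.ext fun i j ↦ hs _ _
  have h1 : metricTrace B A T = ∑ i, ∑ j, (G⁻¹ i j * G j i) • H := by
    refine Finset.sum_congr rfl fun i _ ↦ Finset.sum_congr rfl fun j _ ↦ ?_
    rw [hT _ (b i).2 _ (b j).2, smul_smul, hs]
    rfl
  rw [h1]
  simp only [← Finset.sum_smul, ← Matrix.mul_apply, Matrix.nonsing_inv_mul _ hdet.isUnit]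
  simp

section

variable {F : Type*} [NormedAddCommGroup F] [NormedSpace ℝ F] [FiniteDimensional ℝ F]
  {N : Type*} [TopologicalSpace N] [ChartedSpace F N] [IsManifold 𝓘(ℝ, F) ∞ N]
  {E : Type*} [NormedAddCommGroup E] [NormedSpace ℝ E] [FiniteDimensional ℝ E]
  {M : Type*} [TopologicalSpace M] [ChartedSpace E M] [IsManifold 𝓘(ℝ, E) ∞ M]
  {K : IndefiniteKahler F N}

omit [FiniteDimensional ℝ E] [IsManifold 𝓘(ℝ, E) ∞ M] in
/-- A vector orthogonal to every smooth local section of a subbundle is orthogonal to its fibre. -/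
theorem IsSubbundle.metric_eq_zero {f : M → N}
    {A : ∀ p : M, Submodule ℝ (TangentSpace 𝓘(ℝ, F) (f p))} (hA : IsSubbundle E f A) {p : M}
    {H : TangentSpace 𝓘(ℝ, F) (f p)}
    (h : ∀ (U : Set M) (W : ∀ q : M, TangentSpace 𝓘(ℝ, F) (f q)), IsOpen U →
      SmoothAlongOn E f W U → (∀ q ∈ U, W q ∈ A q) → p ∈ U → K.metric (f p) (W p) H = 0) :
    ∀ w ∈ A p, K.metric (f p) w H = 0 := by
  obtain ⟨k, hk⟩ := hA
  obtain ⟨U, hU, hpU, s, hs, hspan⟩ := hk p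
  intro w hw
  rw [← (hspan p hpU).2] at hw
  induction hw using Submodule.span_induction with
  | mem x hx =>
    obtain ⟨i, rfl⟩ := hx
    refine h U (s i) hU (hs i) (fun q hq ↦ ?_) hpU
    rw [← (hspan q hq).2]
    exact Submodule.subset_span ⟨i, rfl⟩
  | zero => simp
  | add x y _ _ hx hy => simp [hx, hy]
  | smul a x _ hx => simp [hx]

/-! ### Orthogonality relations and Weingarten formulas -/

namespace LightlikeSubmanifold

variable (L : LightlikeSubmanifold K E M) (p : M)

theorem d_mem_tan (x : TangentSpace 𝓘(ℝ, E) p) : L.d p x ∈ L.tan p := ⟨x, rfl⟩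

theorem screen_le_tan : L.screen p ≤ L.tan p :=
  le_sup_left.trans (L.screen_sup p).le

theorem coscreen_le_normalSpace : L.coscreen p ≤ normalSpace E K L.toFun p :=
  L.coscreen_sup p ▸ le_sup_left

theorem rad_le_normalSpace : L.rad p ≤ normalSpace E K L.toFun p := inf_le_right

theorem g_apply (x y : TangentSpace 𝓘(ℝ, E) p) :
    L.g p x y = K.metric (L.toFun p) (L.d p x) (L.d p y) := rfl

theorem g_symm (x y : TangentSpace 𝓘(ℝ, E) p) : L.g p x y = L.g p y x :=
  K.metric_symm _ _ _

variable {L p}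

theorem metric_tan_normalSpace {u v : L.Ambient p} (hu : u ∈ L.tan p)
    (hv : v ∈ normalSpace E K L.toFun p) : K.metric (L.toFun p) u v = 0 :=
  hv u hu

theorem metric_normalSpace_tan {u v : L.Ambient p} (hu : u ∈ normalSpace E K L.toFun p)
    (hv : v ∈ L.tan p) : K.metric (L.toFun p) u v = 0 := by
  rw [K.metric_symm]
  exact hu v hv

theorem metric_screen_ltr {u v : L.Ambient p} (hu : u ∈ L.screen p) (hv : v ∈ L.ltr p) :
    K.metric (L.toFun p) u v = 0 := by
  have h : v ∈ (K.form (L.toFun p)).orthogonal (L.screen p ⊔ L.coscreen p) :=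
    L.ltr_sup p ▸ Submodule.mem_sup_right hv
  exact h u (Submodule.mem_sup_left hu)

theorem metric_coscreen_ltr {u v : L.Ambient p} (hu : u ∈ L.coscreen p) (hv : v ∈ L.ltr p) :
    K.metric (L.toFun p) u v = 0 := by
  have h : v ∈ (K.form (L.toFun p)).orthogonal (L.screen p ⊔ L.coscreen p) :=
    L.ltr_sup p ▸ Submodule.mem_sup_right hv
  exact h u (Submodule.mem_sup_right hu)

theorem metric_screen_tr {u v : L.Ambient p} (hu : u ∈ L.screen p) (hv : v ∈ L.tr p) :
    K.metric (L.toFun p) u v = 0 := by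
  obtain ⟨a, ha, c, hc, rfl⟩ := Submodule.mem_sup.1 hv
  rw [map_add, metric_screen_ltr hu ha,
    metric_tan_normalSpace (L.screen_le_tan p hu) (L.coscreen_le_normalSpace p hc), add_zero]

/-- Screen vectors are already orthogonal to Rad(TM), so a screen vector orthogonal to the screen is
orthogonal to TM. It is then radical, and the screen meets the radical only in zero. -/
theorem eq_zero_of_mem_screen {u : L.Ambient p} (hu : u ∈ L.screen p)
    (h : ∀ v ∈ L.screen p, K.metric (L.toFun p) u v = 0) : u = 0 := by
  refine Submodule.disjoint_def.1 (L.screen_disjoint p) u hu ⟨L.screen_le_tan p hu, fun v hv ↦ ?_⟩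
  rw [← L.screen_sup p] at hv
  obtain ⟨s, hs, t, ht, rfl⟩ := Submodule.mem_sup.1 hv
  change K.metric (L.toFun p) (s + t) u = 0
  rw [K.metric_symm, map_add, h s hs,
    metric_tan_normalSpace (L.screen_le_tan p hu) (L.rad_le_normalSpace p ht), add_zero]

/-- A transversal vector orthogonal to `S(TM^⊥)` and to `Rad(TM)` vanishes. -/
theorem eq_zero_of_mem_tr {u : L.Ambient p} (hu : u ∈ L.tr p)
    (hc : ∀ w ∈ L.coscreen p, K.metric (L.toFun p) w u = 0)
    (hr : ∀ w ∈ L.rad p, K.metric (L.toFun p) w u = 0) : u = 0 := by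
  -- The lightlike transversal bundle is totally null and orthogonal to S(TM^⊥), so it pairs to zero
  -- with every transversal vector.
  have hl : ∀ w ∈ L.ltr p, K.metric (L.toFun p) w u = 0 := by
    intro w hw
    obtain ⟨a, ha, c, hc', rfl⟩ := Submodule.mem_sup.1 hu
    rw [map_add, L.ltr_null p w hw a ha, K.metric_symm, metric_coscreen_ltr hc' hw, add_zero]
  refine (K.metric_nondegenerate (L.toFun p)).2 u fun v ↦ ?_
  have hv : v ∈ (L.screen p ⊔ L.coscreen p) ⊔ (L.rad p ⊔ L.ltr p) := by
    rw [(L.isCompl_aux p).2.sup_eq_top]; trivial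
  obtain ⟨_, h1, _, h2, rfl⟩ := Submodule.mem_sup.1 hv
  obtain ⟨s, hs, c, hc', rfl⟩ := Submodule.mem_sup.1 h1
  obtain ⟨r, hr', l, hl', rfl⟩ := Submodule.mem_sup.1 h2
  change K.metric (L.toFun p) (s + c + (r + l)) u = 0
  simp only [map_add, add_apply, metric_screen_tr hs hu, hc c hc', hr r hr', hl l hl', add_zero]

/-- The discarded part lies in tr(TM), which is orthogonal to the screen. It need not be orthogonal
to Rad(TM), hence the restriction on `v`. -/
theorem metric_projTan {u v : L.Ambient p} (hv : v ∈ L.screen p) :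
    K.metric (L.toFun p) (L.projTan p u) v = K.metric (L.toFun p) u v := by
  have h : u - L.projTan p u ∈ L.tr p := by
    rw [← Submodule.projection_apply_eq_zero_iff (L.isCompl_tan_tr p), map_sub]
    change L.projTan p u - L.projTan p (L.projTan p u) = 0
    rw [sub_eq_zero]
    exact (Submodule.projection_apply_of_mem_left (L.isCompl_tan_tr p)
      (Submodule.projection_apply_mem _ _)).symm
  have := metric_screen_tr hv h
  rw [map_sub, sub_eq_zero] at this
  rw [K.metric_symm, ← this, K.metric_symm]

theorem projTan_mem (u : L.Ambient p) : L.projTan p u ∈ L.tan p :=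
  Submodule.projection_apply_mem _ _

/-- For a tangent vector the discarded part is radical, hence orthogonal to TM. -/
theorem metric_projScreen {u v : L.Ambient p} (hu : u ∈ L.tan p) (hv : v ∈ L.screen p) :
    K.metric (L.toFun p) (L.projScreen p u) v = K.metric (L.toFun p) u v := by
  obtain ⟨s, hs, t, ht, rfl⟩ := Submodule.mem_sup.1 ((L.screen_sup p).ge hu)
  have h1 : L.projScreen p s = s := Submodule.projection_apply_of_mem_left _ hs
  have h2 : L.projScreen p t = 0 :=
    (Submodule.projection_apply_eq_zero_iff _).2 (Submodule.mem_sup_left ht)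
  rw [map_add, h1, h2, add_zero, map_add, add_apply,
    metric_normalSpace_tan (L.rad_le_normalSpace p ht) (L.screen_le_tan p hv), add_zero]

/-- The Weingarten formula for sections of the normal bundle. -/
theorem metric_covAlong_normal {W : ∀ q : M, L.Ambient q} {U : Set M} (hU : IsOpen U)
    (hW : SmoothAlongOn E L.toFun W U) (hWn : ∀ q ∈ U, W q ∈ normalSpace E K L.toFun q)
    (hp : p ∈ U) (x y : TangentSpace 𝓘(ℝ, E) p) :
    K.metric (L.toFun p) (covAlong K L.toFun W p x) (L.d p y) =
      -K.metric (L.toFun p) (W p) (L.h p x y) := by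
  set Y := FiberBundle.extend E y with hY
  have hYd : MDiffAt (T% Y) p := FiberBundle.mdifferentiableAt_extend ..
  have hYp : Y p = y := FiberBundle.extend_apply_self ..
  have hWd : MDiffAt (fun q ↦ (⟨L.toFun q, W q⟩ : TangentBundle 𝓘(ℝ, F) N)) p :=
    (hW.contMDiffAt (hU.mem_nhds hp)).mdifferentiableAt (by simp)
  have hder := mvfderiv_metric_along K hWd (L.mdifferentiableAt_d hYd) x
  -- The function to differentiate vanishes on all of `U`, since `W` is normal there.
  have hzero : (fun q ↦ K.metric (L.toFun q) (W q) (L.d q (Y q))) =ᶠ[nhds p] fun _ ↦ (0 : ℝ) := by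
    filter_upwards [hU.mem_nhds hp] with q hq
    exact metric_normalSpace_tan (hWn q hq) (L.d_mem_tan q _)
  have h0 : mvfderiv 𝓘(ℝ, E) (fun q ↦ K.metric (L.toFun q) (W q) (L.d q (Y q))) p = 0 := by
    rw [← mvfderiv_const (I := 𝓘(ℝ, E)) (0 : ℝ) (x := p)]
    simp only [mvfderiv, hzero.mfderiv_eq]
    rfl
  have hh := L.h_apply hYd x
  -- The difference is the tangential part of the derivative, which the normal vector `W p` does not
  -- see.
  have hsplit : covAlong K L.toFun (fun q ↦ L.d q (Y q)) p x - L.h p x y ∈ L.tan p := by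
    rw [← hYp, hh, ← Submodule.projection_apply_eq_zero_iff (L.isCompl_tan_tr p).symm, map_sub,
      sub_eq_zero]
    exact (Submodule.projection_apply_of_mem_left (L.isCompl_tan_tr p).symm
      (Submodule.projection_apply_mem _ _)).symm
  have := metric_normalSpace_tan (hWn p hp) hsplit
  rw [map_sub, sub_eq_zero] at this
  rw [h0, zero_apply, this, hYp] at hder
  linarith

theorem metric_shapeOperator {W : ∀ q : M, L.Ambient q} {U : Set M} (hU : IsOpen U)
    (hW : SmoothAlongOn E L.toFun W U) (hWn : ∀ q ∈ U, W q ∈ normalSpace E K L.toFun q)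
    (hp : p ∈ U) (x : TangentSpace 𝓘(ℝ, E) p) {y : TangentSpace 𝓘(ℝ, E) p}
    (hy : L.d p y ∈ L.screen p) :
    K.metric (L.toFun p) (L.shapeOperator W p x) (L.d p y) =
      K.metric (L.toFun p) (W p) (L.h p x y) := by
  have h : L.shapeOperator W p x = -L.projTan p (covAlong K L.toFun W p x) := rfl
  rw [h, map_neg, neg_apply, metric_projTan hy, metric_covAlong_normal hU hW hWn hp, neg_neg]

theorem metric_screenShapeOperator {W : ∀ q : M, L.Ambient q} {U : Set M} (hU : IsOpen U)
    (hW : SmoothAlongOn E L.toFun W U) (hWn : ∀ q ∈ U, W q ∈ normalSpace E K L.toFun q)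
    (hp : p ∈ U) (x : TangentSpace 𝓘(ℝ, E) p) {y : TangentSpace 𝓘(ℝ, E) p}
    (hy : L.d p y ∈ L.screen p) :
    K.metric (L.toFun p) (L.screenShapeOperator W p x) (L.d p y) =
      K.metric (L.toFun p) (W p) (L.h p x y) := by
  have h : L.screenShapeOperator W p x =
    -L.projScreen p (L.projTan p (covAlong K L.toFun W p x)) := rfl
  rw [h, map_neg, neg_apply, metric_projScreen (L.projTan_mem _) hy,
    metric_projTan hy, metric_covAlong_normal hU hW hWn hp, neg_neg]

/-! ### Traces over subspaces of the tangent space -/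

theorem d_injective : Function.Injective (L.d p) := L.injective_mfderiv p

/-- Traces are taken in the tangent space of `M`, while the distributions live in the ambient one;
this carries nondegeneracy across. -/
theorem comap_d_nondegenerate {A : Submodule ℝ (L.Ambient p)} (hA : A ≤ L.tan p)
    (h : ∀ u ∈ A, (∀ v ∈ A, K.metric (L.toFun p) u v = 0) → u = 0) :
    ∀ x ∈ A.comap (L.d p), (∀ y ∈ A.comap (L.d p), L.g p x y = 0) → x = 0 := by
  intro x hx hxy
  refine d_injective (L := L) ?_
  rw [map_zero]
  refine h _ hx fun v hv ↦ ?_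
  obtain ⟨y, rfl⟩ := hA hv
  exact hxy y hv

theorem finrank_comap_d_eq_zero {A : Submodule ℝ (L.Ambient p)} (hA : A ≤ L.tan p) :
    finrank ℝ (A.comap (L.d p)) = 0 ↔ A = ⊥ := by
  rw [Submodule.finrank_eq_zero]
  constructor
  · intro h
    rw [Submodule.eq_bot_iff]
    intro v hv
    obtain ⟨y, rfl⟩ := hA hv
    have : y ∈ A.comap (L.d p) := hv
    rw [h, Submodule.mem_bot] at this
    subst this
    exact map_zero (L.d p)
  · rintro rfl
    exact LinearMap.ker_eq_bot.2 d_injective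

/-- The trace of an operator that is conformal to the induced metric. -/
theorem traceOn_eq {A : Submodule ℝ (L.Ambient p)} (hA : A ≤ L.tan p)
    (h : ∀ u ∈ A, (∀ v ∈ A, K.metric (L.toFun p) u v = 0) → u = 0)
    {T : TangentSpace 𝓘(ℝ, E) p →ₗ[ℝ] L.Ambient p} {c : ℝ}
    (hT : ∀ x y, L.d p x ∈ A → L.d p y ∈ A →
      K.metric (L.toFun p) (T x) (L.d p y) = L.g p x y * c) :
    L.traceOn p A T = finrank ℝ (A.comap (L.d p)) * c :=
  metricTrace_eq_finrank_smul (L.g_symm p) (comap_d_nondegenerate hA h)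
    fun x hx y hy ↦ hT x y hx hy

/-! ### Algebra of the STCR distributions -/

namespace STCR

variable (C : L.STCR)

theorem imageJ_S_le : L.imageJ (C.S p) ≤ C.D' p := by
  rintro _ ⟨s, hs, rfl⟩
  have : s ∈ L.imageJ (C.D' p) := C.J_D'_eq p ▸ Submodule.mem_sup_right hs
  obtain ⟨v, hv, rfl⟩ := this
  exact (K.J_J _ v).symm ▸ neg_mem hv

theorem imageJ_L₁_le : L.imageJ (C.L₁ p) ≤ C.D' p := by
  rintro _ ⟨s, hs, rfl⟩
  have : s ∈ L.imageJ (C.D' p) := C.J_D'_eq p ▸ Submodule.mem_sup_left hs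
  obtain ⟨v, hv, rfl⟩ := this
  exact (K.J_J _ v).symm ▸ neg_mem hv

/-- Apply J̄ to J̄(D') = L₁ ⊥ S and use J̄² = -1. -/
theorem D'_eq : C.D' p = L.imageJ (C.L₁ p) ⊔ L.imageJ (C.S p) := by
  refine le_antisymm (fun v hv ↦ ?_) (sup_le C.imageJ_L₁_le C.imageJ_S_le)
  have h : K.Jlin _ v ∈ C.L₁ p ⊔ C.S p := C.J_D'_eq p ▸ Submodule.mem_map_of_mem hv
  have h2 := Submodule.mem_map_of_mem (f := K.Jlin _) h
  rw [Submodule.map_sup] at h2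
  have h3 : K.Jlin _ (K.Jlin _ v) = -v := K.J_J _ v
  rw [h3] at h2
  exact neg_mem_iff.1 h2

theorem D₀JS_le_screen : C.D₀JS p ≤ L.screen p := by
  rw [C.screen_eq p]
  exact sup_le le_sup_right (C.imageJ_S_le.trans (le_sup_right.trans le_sup_left))

/-- The rest of the screen is J̄(D₁) and J̄(L₁). Both are orthogonal to D₀ by the STCR
decomposition, and to J̄(S) because J̄ is an isometry and S(TM^⊥) is orthogonal to Rad(TM) and
ltr(TM). Orthogonality to D₀ ⊥ J̄(S) therefore implies orthogonality to the whole screen, which is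
nondegenerate. -/
theorem D₀JS_nondegenerate : ∀ u ∈ C.D₀JS p,
    (∀ v ∈ C.D₀JS p, K.metric (L.toFun p) u v = 0) → u = 0 := by
  intro u hu h
  refine eq_zero_of_mem_screen (C.D₀JS_le_screen hu) fun v hv ↦ ?_
  rw [C.screen_eq p, C.D'_eq] at hv
  obtain ⟨_, h1, d₀, hd₀, rfl⟩ := Submodule.mem_sup.1 hv
  obtain ⟨j, hj, _, h2, rfl⟩ := Submodule.mem_sup.1 h1
  obtain ⟨l, hl, s', hs', rfl⟩ := Submodule.mem_sup.1 h2
  obtain ⟨a, ha, t, ht, rfl⟩ := Submodule.mem_sup.1 hu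
  have e1 := h d₀ (Submodule.mem_sup_left hd₀)
  have e2 := h s' (Submodule.mem_sup_right hs')
  have e3 : K.metric (L.toFun p) a j = 0 := by
    rw [K.metric_symm]
    exact C.screen_orthogonal p j (Submodule.mem_sup_left hj) a ha
  have e4 : K.metric (L.toFun p) a l = 0 := by
    rw [K.metric_symm]
    exact C.screen_orthogonal p l (Submodule.mem_sup_right (C.imageJ_L₁_le hl)) a ha
  obtain ⟨t, ht, rfl⟩ := ht
  obtain ⟨j, hj, rfl⟩ := hj
  obtain ⟨l, hl, rfl⟩ := hl
  have htc := C.S_le p ht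
  have hjr : j ∈ L.rad p := C.rad_eq p ▸ Submodule.mem_sup_left hj
  have e5 : K.metric (L.toFun p) (K.Jlin _ t) (K.Jlin _ j) = 0 :=
    (K.metric_J_J _ _ _).trans
      (metric_normalSpace_tan (L.coscreen_le_normalSpace p htc) hjr.1)
  have e6 : K.metric (L.toFun p) (K.Jlin _ t) (K.Jlin _ l) = 0 :=
    (K.metric_J_J _ _ _).trans (metric_coscreen_ltr htc (C.L₁_le p hl))
  rw [map_add (K.metric _ _), e1, map_add (K.metric _ _), map_add (K.metric _ _), e2]
  simp only [map_add, add_apply, e3, e4, e5, e6, add_zero]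

/-- Where `D₁` and `D₀ ⊥ J̄(S)` vanish, the screen is the image of a totally null space. -/
theorem screen_eq_bot (h₁ : C.D₁ p = ⊥) (h₀ : C.D₀JS p = ⊥) : L.screen p = ⊥ := by
  obtain ⟨h2, h3⟩ := sup_eq_bot_iff.1 h₀
  have hscr : L.screen p = L.imageJ (C.L₁ p) := by
    rw [C.screen_eq p, h2, C.D'_eq, h3, h₁]
    simp [imageJ]
  rw [Submodule.eq_bot_iff]
  intro u hu
  refine eq_zero_of_mem_screen hu fun v hv ↦ ?_
  rw [hscr] at hu hv
  obtain ⟨a, ha, rfl⟩ := hu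
  obtain ⟨b, hb, rfl⟩ := hv
  exact (K.metric_J_J _ _ _).trans (L.ltr_null p a (C.L₁_le p ha) b (C.L₁_le p hb))

end STCR

end LightlikeSubmanifold

end

end LightlikeGeometry

/-! ### Minimality and vanishing traces -/

theorem theorem5p1
    {F : Type*} [NormedAddCommGroup F] [NormedSpace ℝ F] [FiniteDimensional ℝ F]
    {N : Type*} [TopologicalSpace N] [ChartedSpace F N] [IsManifold 𝓘(ℝ, F) ∞ N]
    {E : Type*} [NormedAddCommGroup E] [NormedSpace ℝ E] [FiniteDimensional ℝ E]
    {M : Type*} [TopologicalSpace M] [ChartedSpace E M] [IsManifold 𝓘(ℝ, E) ∞ M]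
    (K : LightlikeGeometry.IndefiniteKahler F N)
    (L : LightlikeGeometry.LightlikeSubmanifold K E M)
    (C : L.STCR)
    (hC : ∀ p : M, C.D₁ p ≠ ⊥ → C.D₀JS p ≠ ⊥)
    (hL : L.IsTotallyUmbilical) :
    L.IsMinimal ↔
      (∀ (U : Set M) (W : ∀ q : M, L.Ambient q), IsOpen U →
        LightlikeGeometry.SmoothAlongOn E L.toFun W U → (∀ q ∈ U, W q ∈ L.coscreen q) →
        ∀ p ∈ U, L.traceOn p (C.D₀JS p) (L.shapeOperator W p) = 0) ∧
      (∀ (U : Set M) (ξ : ∀ q : M, L.Ambient q), IsOpen U →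
        LightlikeGeometry.SmoothAlongOn E L.toFun ξ U → (∀ q ∈ U, ξ q ∈ L.rad q) →
        ∀ p ∈ U, L.traceOn p (C.D₀JS p) (L.screenShapeOperator ξ p) = 0) := by
  obtain ⟨H, -, hHtr, hH⟩ := hL
  have hB : ∀ p, C.D₀JS p ≤ L.tan p := fun p ↦ C.D₀JS_le_screen.trans (L.screen_le_tan p)
  have traceW : ∀ (U : Set M) (W : ∀ q : M, L.Ambient q), IsOpen U →
      LightlikeGeometry.SmoothAlongOn E L.toFun W U → (∀ q ∈ U, W q ∈ L.coscreen q) →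
      ∀ p ∈ U, L.traceOn p (C.D₀JS p) (L.shapeOperator W p) =
        finrank ℝ ((C.D₀JS p).comap (L.d p)) * K.metric (L.toFun p) (W p) (H p) := by
    intro U W hU hW hWc p hp
    refine L.traceOn_eq (hB p) C.D₀JS_nondegenerate fun x y _ hy ↦ ?_
    rw [L.metric_shapeOperator hU hW (fun q hq ↦ L.coscreen_le_normalSpace q (hWc q hq)) hp x
      (C.D₀JS_le_screen hy), hH, map_smul, smul_eq_mul]
  have traceξ : ∀ (U : Set M) (ξ : ∀ q : M, L.Ambient q), IsOpen U →
      LightlikeGeometry.SmoothAlongOn E L.toFun ξ U → (∀ q ∈ U, ξ q ∈ L.rad q) →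
      ∀ p ∈ U, L.traceOn p (C.D₀JS p) (L.screenShapeOperator ξ p) =
        finrank ℝ ((C.D₀JS p).comap (L.d p)) * K.metric (L.toFun p) (ξ p) (H p) := by
    intro U ξ hU hξ hξr p hp
    refine L.traceOn_eq (hB p) C.D₀JS_nondegenerate fun x y _ hy ↦ ?_
    rw [L.metric_screenShapeOperator hU hξ (fun q hq ↦ L.rad_le_normalSpace q (hξr q hq)) hp x
      (C.D₀JS_le_screen hy), hH, map_smul, smul_eq_mul]
  have hmin : L.IsMinimal ↔ ∀ p, L.screen p = ⊥ ∨ H p = 0 := by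
    have htr : ∀ p, LightlikeGeometry.metricTrace (L.g p) ((L.screen p).comap (L.d p)) (L.h p) =
        (finrank ℝ ((L.screen p).comap (L.d p)) : ℝ) • H p := fun p ↦
      LightlikeGeometry.metricTrace_eq_finrank_smul (L.g_symm p)
        (L.comap_d_nondegenerate (L.screen_le_tan p) fun u hu ↦ L.eq_zero_of_mem_screen hu)
        fun x _ y _ ↦ hH p x y
    have hiff : ∀ p, LightlikeGeometry.metricTrace (L.g p) ((L.screen p).comap (L.d p)) (L.h p) = 0
        ↔ L.screen p = ⊥ ∨ H p = 0 := fun p ↦ by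
      rw [htr, smul_eq_zero, Nat.cast_eq_zero, L.finrank_comap_d_eq_zero (L.screen_le_tan p)]
    -- The remaining goal is the vanishing of hˢ on the radical, where g is zero.
    refine ⟨fun h p ↦ (hiff p).1 (h.2 p), fun h ↦ ⟨fun p x y hx _ ↦ ?_, fun p ↦ (hiff p).2 (h p)⟩⟩
    rw [hH, L.g_apply, L.metric_normalSpace_tan (L.rad_le_normalSpace p hx) (L.d_mem_tan p y),
      zero_smul, map_zero]
  rw [hmin]
  constructor
  · intro h
    -- One identity serves both families: either the screen, and with it D₀ ⊥ J̄(S), is zero, or H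
    -- is.
    have hzero : ∀ p (w : L.Ambient p),
        (finrank ℝ ((C.D₀JS p).comap (L.d p)) : ℝ) * K.metric (L.toFun p) w (H p) = 0 := by
      intro p w
      rcases h p with h | h
      · rw [(L.finrank_comap_d_eq_zero (hB p)).2 (le_bot_iff.1 (h ▸ C.D₀JS_le_screen)),
          Nat.cast_zero, zero_mul]
      · rw [h, map_zero, mul_zero]
    exact ⟨fun U W hU hW hWc p hp ↦ (traceW U W hU hW hWc p hp).trans (hzero p _),
      fun U ξ hU hξ hξr p hp ↦ (traceξ U ξ hU hξ hξr p hp).trans (hzero p _)⟩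
  · rintro ⟨hW, hξ⟩ p
    by_cases hp : C.D₀JS p = ⊥
    · exact Or.inl (C.screen_eq_bot (by_contra fun h ↦ hC p h hp) hp)
    right
    have hne : (finrank ℝ ((C.D₀JS p).comap (L.d p)) : ℝ) ≠ 0 := by
      rwa [Ne, Nat.cast_eq_zero, L.finrank_comap_d_eq_zero (hB p)]
    refine L.eq_zero_of_mem_tr (hHtr p) ?_ fun w hw ↦ ?_
    · refine L.coscreen_subbundle.metric_eq_zero fun U W hU hWs hWc hpU ↦ ?_
      have := hW U W hU hWs hWc p hpU
      rw [traceW U W hU hWs hWc p hpU] at this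
      exact (mul_eq_zero.1 this).resolve_left hne
    · have key : ∀ (U : Set M) (ξ : ∀ q : M, L.Ambient q), IsOpen U →
          LightlikeGeometry.SmoothAlongOn E L.toFun ξ U → (∀ q ∈ U, ξ q ∈ L.rad q) → p ∈ U →
          K.metric (L.toFun p) (ξ p) (H p) = 0 := by
        intro U ξ hU hξs hξr hpU
        have := hξ U ξ hU hξs hξr p hpU
        rw [traceξ U ξ hU hξs hξr p hpU] at this
        exact (mul_eq_zero.1 this).resolve_left hne
      -- Local frames are given for D₁ and D₂ rather than for Rad(TM). Their sections are radical,
      -- and together they span it.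
      rw [C.rad_eq p] at hw
      obtain ⟨a, ha, b, hb, rfl⟩ := Submodule.mem_sup.1 hw
      have ha0 := C.D₁_subbundle.metric_eq_zero (fun U W hU hWs hWc hpU ↦ key U W hU hWs
        (fun q hq ↦ C.rad_eq q ▸ Submodule.mem_sup_left (hWc q hq)) hpU) a ha
      have hb0 := C.D₂_subbundle.metric_eq_zero (fun U W hU hWs hWc hpU ↦ key U W hU hWs
        (fun q hq ↦ C.rad_eq q ▸ Submodule.mem_sup_right (hWc q hq)) hpU) b hb
      rw [map_add, add_apply, ha0, hb0, add_zero]
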